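/- **Definitions.** A *projection algebra* is a set $P$ with two binary operations $\times,\star$ such that for all $e,f,g\in P$: $e\times e=e$, $(e\times f)\times e=e\times f$, $e\times(f\times g)=(e\times f)\times(f\times g)$, $(e\times f)\times g=(e\times f)\times(e\times g)$; $e\star e=e$, $f\star e=e\star(f\star e)$, $(g\star f)\star e=(g\star f)\star(f\star e)$, $g\star(f\star e)=(g\star e)\star(f\star e)$; $(e\star(f\times g))\star g=(e\star f)\star g$, $g\times((g\star f)\times e)=g\times(f\times e)$; $(e\times f)\star e=e\times f$, $f\times(e\star f)=e\star f$. It is *strong* if moreover $e\times(((e\times f)\times g)\star f)=(e\times f)\times g$ and $(f\times(g\star(f\star e)))\star e=g\star(f\star e)$. A homomorphism of projection algebras is a map preserving $\times$ and $\star$. Write $e\le f$ if $e=f\times e$, and $p\,\mathcal F\,q$ if $p\times q=p$ and $p\star q=q$. A *DRC-restriction semigroup* is a semigroup $S$ with two unary operations ${}^+,{}^*$ such that for all $x,y\in S$: $x^+x=x$, $(xy)^+=(xy^+)^+$, $(xy)^+=x^+(xy)^+x^+$, $x^{++}=x^+$, $x^{+*}=x^+$, $xx^*=x$, $(xy)^*=(x^*y)^*$,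 $(xy)^*=y^*(xy)^*y^*$, $x^{**}=x^*$, $x^{*+}=x^*$, $x(yx)^*=(yx^+)^*x$ and $(xy)^+x=x(x^*y)^+$. Its projection algebra is $P(S)=\{x^+\mid x\in S\}$ with $e\times_S f=(ef)^+$, $e\star_S f=(ef)^*$. A *$(2,1,1)$-homomorphism* is a map preserving the multiplication, ${}^+$ and ${}^*$. Let $P$ be a strong projection algebra. A *$P$-path* is a sequence $\mathfrak p=(p_1,\dots,p_k)$, $k\ge1$, in $P$ with $p_1\,\mathcal F\,p_2\,\mathcal F\cdots\mathcal F\,p_k$; put $\mathbf d(\mathfrak p)=p_1$, $\mathbf r(\mathfrak p)=p_k$, and if $p_k=q_1$ put $(p_1,\dots,p_k)\circ(q_1,\dots,q_l)=(p_1,\dots,p_k,q_2,\dots,q_l)$. Let $\approx_P$ be the congruence on the resulting category of $P$-paths generated by the pairs $((p,p),(p))$ for $p\in P$ and $((e,e\star p,f),(e,p\times f,f))$ for $e,p,f\in P$ with $f=(e\star p)\star f$ and $e=e\times(p\times f)$, and let $[p_1,\dots,p_k]$ be the class of $(p_1,\dots,p_k)$. For $q\le p_1$ let ${}_q{\downharpoonleft}\mathfrak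 p=(q_1,\dots,q_k)$ with $q_1=q$, $q_i=q_{i-1}\star p_i$; for $q\le p_k$ let $\mathfrak p{\downharpoonright}_q=(q_1,\dots,q_k)$ with $q_k=q$, $q_i=p_i\times q_{i+1}$. The *chain semigroup* $\mathbf S(\mathscr C(P))$ is the set of $\approx_P$-classes of $P$-paths with the (well-defined) operations $$[\mathfrak p]\bullet[\mathfrak q]=\bigl[\mathfrak p{\downharpoonright}_{s}\circ(s,t)\circ{}_{t}{\downharpoonleft}\mathfrak q\bigr],\quad s=\mathbf r(\mathfrak p)\times\mathbf d(\mathfrak q),\ t=\mathbf r(\mathfrak p)\star\mathbf d(\mathfrak q),\qquad [\mathfrak p]^+=[\mathbf d(\mathfrak p)],\qquad [\mathfrak p]^*=[\mathbf r(\mathfrak p)].$$ **Theorem.** Let $S$ be a DRC-restriction semigroup, $P$ a strong projection algebra, and $\phi:P\to P(S)$ a homomorphism of projection algebras. Then $\mathbf S(\mathscr C(P))$ is a DRC-restriction semigroup, and there is a unique $(2,1,1)$-homomorphism $\Phi:\mathbf S(\mathscr C(P))\to S$ such that $[p]\Phi=p\phi$ for all $p\in P$. Moreover, $$[p_1,p_2,\dots,p_k]\,\Phi=(p_1\phi)(p_2\phi)\cdots(p_k\phi)$$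 for every $P$-path $(p_1,\dots,p_k)$. -/

import Mathlib

/-- Two binary operations on a set, written `e ×ₚ f` and `e ⋆ₚ f`. -/
class ProjectionOps (P : Type*) where
  times : P → P → P
  star : P → P → P

infixl:70 " ×ₚ " => ProjectionOps.times
infixl:70 " ⋆ₚ " => ProjectionOps.star

/-- Two-sided projection algebras. -/
class IsProjectionAlgebra (P : Type*) [ProjectionOps P] : Prop where
  L1 : ∀ e : P, e ×ₚ e = e
  L2 : ∀ e f : P, (e ×ₚ f) ×ₚ e = e ×ₚ f
  L3 : ∀ e f g : P, e ×ₚ (f ×ₚ g) = (e ×ₚ f) ×ₚ (f ×ₚ g)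
  L4 : ∀ e f g : P, (e ×ₚ f) ×ₚ g = (e ×ₚ f) ×ₚ (e ×ₚ g)
  R1 : ∀ e : P, e ⋆ₚ e = e
  R2 : ∀ e f : P, f ⋆ₚ e = e ⋆ₚ (f ⋆ₚ e)
  R3 : ∀ e f g : P, (g ⋆ₚ f) ⋆ₚ e = (g ⋆ₚ f) ⋆ₚ (f ⋆ₚ e)
  R4 : ∀ e f g : P, g ⋆ₚ (f ⋆ₚ e) = (g ⋆ₚ e) ⋆ₚ (f ⋆ₚ e)
  P3_star : ∀ e f g : P, (e ⋆ₚ (f ×ₚ g)) ⋆ₚ g = (e ⋆ₚ f) ⋆ₚ g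
  P3_times : ∀ e f g : P, g ×ₚ ((g ⋆ₚ f) ×ₚ e) = g ×ₚ (f ×ₚ e)
  P4_times : ∀ e f : P, (e ×ₚ f) ⋆ₚ e = e ×ₚ f
  P4_star : ∀ e f : P, f ×ₚ (e ⋆ₚ f) = e ⋆ₚ f

/-- Strong two-sided projection algebras. -/
class IsStrongProjectionAlgebra (P : Type*) [ProjectionOps P] : Prop
    extends IsProjectionAlgebra P where
  SP1 : ∀ e f g : P, e ×ₚ (((e ×ₚ f) ×ₚ g) ⋆ₚ f) = (e ×ₚ f) ×ₚ g
  SP2 : ∀ e f g : P, (f ×ₚ (g ⋆ₚ (f ⋆ₚ e))) ⋆ₚ e = g ⋆ₚ (f ⋆ₚ e)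

/-- Homomorphisms of projection algebras: maps preserving both operations. -/
structure ProjectionHom (P Q : Type*) [ProjectionOps P] [ProjectionOps Q] where
  toFun : P → Q
  map_times : ∀ e f : P, toFun (e ×ₚ f) = toFun e ×ₚ toFun f
  map_star : ∀ e f : P, toFun (e ⋆ₚ f) = toFun e ⋆ₚ toFun f

instance (P Q : Type*) [ProjectionOps P] [ProjectionOps Q] :
    CoeFun (ProjectionHom P Q) (fun _ => P → Q) := ⟨ProjectionHom.toFun⟩

/-- A multiplication together with two unary operations `x ↦ x⁺` and `x ↦ x*`. -/
class BiUnary (S : Type*) extends Mul S where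
  plus : S → S
  ast : S → S

/-- DRC-restriction semigroups: an associative multiplication, the DRC conditions (fields
`i` to `v` and their duals), and the DRC-ample conditions (fields `vi` and `vi'`). -/
class IsDRCRestriction (S : Type*) [BiUnary S] : Prop where
  assoc : ∀ x y z : S, (x * y) * z = x * (y * z)
  i : ∀ x : S, BiUnary.plus x * x = x
  i' : ∀ x : S, x * BiUnary.ast x = x
  ii : ∀ x y : S, BiUnary.plus (x * y) = BiUnary.plus (x * BiUnary.plus y)
  ii' : ∀ x y : S, BiUnary.ast (x * y) = BiUnary.ast (BiUnary.ast x * y)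
  iii : ∀ x y : S, BiUnary.plus (x * y) =
    BiUnary.plus x * BiUnary.plus (x * y) * BiUnary.plus x
  iii' : ∀ x y : S, BiUnary.ast (x * y) =
    BiUnary.ast y * BiUnary.ast (x * y) * BiUnary.ast y
  iv : ∀ x : S, BiUnary.plus (BiUnary.plus x) = BiUnary.plus x
  iv' : ∀ x : S, BiUnary.ast (BiUnary.ast x) = BiUnary.ast x
  v : ∀ x : S, BiUnary.ast (BiUnary.plus x) = BiUnary.plus x
  v' : ∀ x : S, BiUnary.plus (BiUnary.ast x) = BiUnary.ast x
  vi : ∀ x y : S, x * BiUnary.ast (y * x) = BiUnary.ast (y * BiUnary.plus x) * x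
  vi' : ∀ x y : S, BiUnary.plus (x * y) * x = x * BiUnary.plus (BiUnary.ast x * y)

/-- (2,1,1)-homomorphisms: maps preserving the multiplication and both unary operations. -/
@[ext]
structure BiUnaryHom (S T : Type*) [BiUnary S] [BiUnary T] where
  toFun : S → T
  map_mul : ∀ x y : S, toFun (x * y) = toFun x * toFun y
  map_plus : ∀ x : S, toFun (BiUnary.plus x) = BiUnary.plus (toFun x)
  map_ast : ∀ x : S, toFun (BiUnary.ast x) = BiUnary.ast (toFun x)

instance (S T : Type*) [BiUnary S] [BiUnary T] :
    CoeFun (BiUnaryHom S T) (fun _ => S → T) := ⟨BiUnaryHom.toFun⟩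

/-- The set of projections `P(S) = {x⁺ | x ∈ S}`. -/
def Projections (S : Type*) [BiUnary S] : Type _ := {e : S // ∃ x : S, BiUnary.plus x = e}

/-- The operations `e ×ₚ f = (e f)⁺` and `e ⋆ₚ f = (e f)*` on `P(S)`. -/
instance (S : Type*) [BiUnary S] [IsDRCRestriction S] : ProjectionOps (Projections S) where
  times e f := ⟨BiUnary.plus (e.1 * f.1), e.1 * f.1, rfl⟩
  star e f := ⟨BiUnary.ast (e.1 * f.1), BiUnary.ast (e.1 * f.1), IsDRCRestriction.v' _⟩

namespace ProjectionAlgebra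

section Basic

variable {P : Type*} [ProjectionOps P]

/-- The natural partial order of a projection algebra. -/
def Le (e f : P) : Prop := e = f ×ₚ e

/-- The relation `p F q`. -/
def Frel (p q : P) : Prop := p ×ₚ q = p ∧ p ⋆ₚ q = q

/-- `(e, p, f)` is an admissible triple. -/
def Admissible (e p f : P) : Prop := f = (e ⋆ₚ p) ⋆ₚ f ∧ e = e ×ₚ (p ×ₚ f)

open IsProjectionAlgebra IsStrongProjectionAlgebra

theorem Le.times_left {e f : P} (h : Le e f) : f ×ₚ e = e := h.symm

section
variable [IsProjectionAlgebra P]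

theorem times_self_left (e f : P) : e ×ₚ (e ×ₚ f) = e ×ₚ f := by
  have := L4 e e f
  rw [L1] at this
  exact this.symm

theorem star_self_right (e f : P) : (e ⋆ₚ f) ⋆ₚ f = e ⋆ₚ f := by
  have := R4 f f e
  rw [R1] at this
  exact this.symm

theorem Le.times_right {e f : P} (h : Le e f) : e ×ₚ f = e := by
  have := L2 f e
  rwa [h.times_left] at this

theorem Le.star_right {e f : P} (h : Le e f) : e ⋆ₚ f = e := by
  have := P4_times f e
  rwa [h.times_left] at this

theorem Le.star_left {e f : P} (h : Le e f) : f ⋆ₚ e = e := by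
  have := R2 f e
  rw [h.star_right] at this
  exact this.symm

theorem le_of_star_right {e f : P} (h : e ⋆ₚ f = e) : Le e f := by
  have := P4_star e f
  rw [h] at this
  exact this.symm

theorem times_le (e f : P) : Le (e ×ₚ f) e := (times_self_left e f).symm

theorem star_le (e f : P) : Le (e ⋆ₚ f) f := le_of_star_right (star_self_right e f)

theorem Le.refl (e : P) : Le e e := (L1 e).symm

theorem Le.trans {p q r : P} (h : Le p q) (h' : Le q r) : Le p r := by
  have := L3 r q p
  rw [h.times_left, h'.times_left, h.times_left] at this
  exact this.symm

theorem times_star_right (e f : P) : (e ×ₚ f) ⋆ₚ f = e ⋆ₚ f := by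
  have := P3_star e e f
  rwa [R1, (times_le e f).star_left] at this

theorem times_star_left (e f : P) : e ×ₚ (e ⋆ₚ f) = e ×ₚ f := by
  have := P3_times f f e
  rwa [L1, (star_le e f).times_right] at this

theorem frel_times_star (p q : P) : Frel (p ×ₚ q) (p ⋆ₚ q) := by
  constructor
  · rw [L4, times_star_left, L1]
  · rw [R4, times_star_right, R1]

theorem frel_self (p : P) : Frel p p := ⟨L1 p, R1 p⟩

theorem Le.antisymm {e f : P} (h : Le e f) (h' : Le f e) : e = f := by
  rw [← h.times_right, h'.times_left]

theorem times_mono (g : P) {e f : P} (h : Le e f) : Le (g ×ₚ e) (g ×ₚ f) := by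
  have := L3 g f e
  rw [h.times_left] at this
  rw [this]
  exact times_le _ _

theorem star_mono (g : P) {e f : P} (h : Le e f) : Le (e ⋆ₚ g) (f ⋆ₚ g) := by
  have := R3 g f e
  rw [h.star_right] at this
  rw [this]
  exact star_le _ _

theorem star_star_self (e f : P) : e ⋆ₚ (e ⋆ₚ f) = e ⋆ₚ f := by rw [R4, R1]

theorem times_times_self (e f : P) : (e ×ₚ f) ×ₚ f = e ×ₚ f := by rw [L4, L1]

end

variable [IsStrongProjectionAlgebra P]

theorem strong_times {e f g : P} (h : Le g (e ×ₚ f)) : e ×ₚ (g ⋆ₚ f) = g := by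
  have := SP1 e f g
  rwa [h.times_left] at this

theorem strong_star {e f g : P} (h : Le g (f ⋆ₚ e)) : (f ×ₚ g) ⋆ₚ e = g := by
  have := SP2 e f g
  rwa [h.star_right] at this

theorem Frel.restrict_left {p q r : P} (h : Frel p q) (hr : Le r p) : Frel r (r ⋆ₚ q) := by
  have h1 : p ×ₚ (r ⋆ₚ q) = r := strong_times (by rw [h.1]; exact hr)
  constructor
  · rw [times_star_left]
    calc r ×ₚ q = (p ×ₚ (r ⋆ₚ q)) ×ₚ q := by rw [h1]
      _ = (p ×ₚ (r ⋆ₚ q)) ×ₚ (p ×ₚ q) := L4 _ _ _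
      _ = r := by rw [h.1, h1, hr.times_right]
  · rw [R4, R1]

theorem Frel.restrict_right {p q r : P} (h : Frel p q) (hr : Le r q) : Frel (p ×ₚ r) r := by
  have h1 : (p ×ₚ r) ⋆ₚ q = r := strong_star (by rw [h.2]; exact hr)
  constructor
  · rw [L4, L1]
  · rw [times_star_right]
    calc p ⋆ₚ r = p ⋆ₚ ((p ×ₚ r) ⋆ₚ q) := by rw [h1]
      _ = (p ⋆ₚ q) ⋆ₚ ((p ×ₚ r) ⋆ₚ q) := R4 _ _ _
      _ = r := by rw [h.2, h1, hr.star_left]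

theorem star_times (p s t : P) : (p ⋆ₚ s) ×ₚ t = (p ×ₚ (s ×ₚ t)) ⋆ₚ s := by
  rw [← P3_times t s p]
  exact (strong_star (times_le (p ⋆ₚ s) t)).symm

theorem star_times_eq (p s t : P) : t ⋆ₚ (s ×ₚ p) = s ×ₚ ((t ⋆ₚ s) ⋆ₚ p) := by
  rw [← P3_star t s p]
  exact (strong_times (star_le t (s ×ₚ p))).symm

theorem Admissible.frel {e p f : P} (h : Admissible e p f) :
    Frel e (e ⋆ₚ p) ∧ Frel (e ⋆ₚ p) f ∧ Frel e (p ×ₚ f) ∧ Frel (p ×ₚ f) f := by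
  obtain ⟨h1, h2⟩ := h
  have he : e ×ₚ p = e := by
    refine (times_le e p).antisymm ?_
    have := times_mono e (times_le p f)
    rwa [← h2] at this
  have hf : p ⋆ₚ f = f := by
    refine (star_le p f).antisymm ?_
    have := star_mono f (star_le e p)
    rwa [← h1] at this
  refine ⟨⟨?_, star_star_self e p⟩, ⟨?_, h1.symm⟩, ⟨h2.symm, ?_⟩, ⟨times_times_self p f, ?_⟩⟩
  · rw [times_star_left, he]
  · rw [star_times, ← h2]
  · rw [star_times_eq, ← h1]
  · rw [times_star_right, hf]

end Basic

/-- `P`-paths `(p₁, p₂, …, p_k)`, `k ≥ 1`: here `p₁` is the head, `(p₂, …, p_k)` the tail,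
and consecutive entries are related by `F`. -/
@[ext]
structure PPath (P : Type*) [ProjectionOps P] where
  head : P
  tail : List P
  chain : (head :: tail).IsChain Frel

namespace PPath

variable {P : Type*} [ProjectionOps P]

/-- The domain `d(𝔭) = p₁`. -/
def dom (a : PPath P) : P := a.head

/-- The last entry of the list `p :: l`. -/
def lastOf : P → List P → P
  | p, [] => p
  | _, q :: l => lastOf q l

/-- The range `r(𝔭) = p_k`. -/
def ran (a : PPath P) : P := lastOf a.head a.tail

/-- The path `(p)` of length one. -/
def single (p : P) : PPath P := ⟨p, [], by simp⟩

/-- The path `(p, q)` for `p F q`. -/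
def pair (p q : P) (h : Frel p q) : PPath P := ⟨p, [q], by simpa using h⟩

/-- The path `(p, q, r)` for `p F q F r`. -/
def triple (p q r : P) (h : Frel p q) (h' : Frel q r) : PPath P :=
  ⟨p, [q, r], by simpa using ⟨h, h'⟩⟩

theorem isChain_append {p : P} {l m : List P} (h : (p :: l).IsChain Frel)
    (h' : (lastOf p l :: m).IsChain Frel) : (p :: (l ++ m)).IsChain Frel := by
  induction l generalizing p with
  | nil => exact h'
  | cons q l ih =>
    rw [List.isChain_cons_cons] at h
    rw [List.cons_append, List.isChain_cons_cons]
    exact ⟨h.1, ih h.2 h'⟩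

/-- The composition `𝔭 ∘ 𝔮 = (p₁, …, p_k = q₁, q₂, …, q_l)`, defined if `r(𝔭) = d(𝔮)`. -/
def comp (a b : PPath P) (h : a.ran = b.dom) : PPath P :=
  ⟨a.head, a.tail ++ b.tail, isChain_append a.chain (by
    have := b.chain
    rwa [show b.head = lastOf a.head a.tail from h.symm] at this)⟩

theorem lastOf_append {P : Type*} (p : P) (l m : List P) : lastOf p (l ++ m) = lastOf (lastOf p l) m := by
  induction l generalizing p with
  | nil => rfl
  | cons q l ih => exact ih q

@[simp] theorem dom_comp (a b : PPath P) (h : a.ran = b.dom) : (a.comp b h).dom = a.dom := rfl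

theorem ran_comp (a b : PPath P) (h : a.ran = b.dom) : (a.comp b h).ran = b.ran := by
  have h' : lastOf a.head a.tail = b.head := h
  simp [ran, comp, lastOf_append, h']

@[simp] theorem dom_single (p : P) : (single p).dom = p := rfl
@[simp] theorem ran_single (p : P) : (single p).ran = p := rfl
@[simp] theorem dom_pair (p q : P) (h : Frel p q) : (pair p q h).dom = p := rfl
@[simp] theorem ran_pair (p q : P) (h : Frel p q) : (pair p q h).ran = q := rfl
@[simp] theorem dom_triple (p q r : P) (h : Frel p q) (h' : Frel q r) :
    (triple p q r h h').dom = p := rfl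
@[simp] theorem ran_triple (p q r : P) (h : Frel p q) (h' : Frel q r) :
    (triple p q r h h').ran = r := rfl

/-- The entries `q₂, q₃, …` of the left restriction: `q₁ = q`, `qᵢ = qᵢ₋₁ ⋆ pᵢ`. -/
def leftTail : P → List P → List P
  | _, [] => []
  | q, p :: l => (q ⋆ₚ p) :: leftTail (q ⋆ₚ p) l

/-- The first entry and the remaining entries of the right restriction of `p :: l`:
`q_k = q`, `qᵢ = pᵢ × qᵢ₊₁`. -/
def rightList (q : P) : P → List P → P × List P
  | _, [] => (q, [])
  | p, p' :: l =>
    (p ×ₚ (rightList q p' l).1, (rightList q p' l).1 :: (rightList q p' l).2)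

theorem lastOf_rightList (q p : P) (l : List P) :
    lastOf (rightList q p l).1 (rightList q p l).2 = q := by
  induction l generalizing p with
  | nil => rfl
  | cons p' l ih => exact ih p'

theorem leftTail_append (q : P) (l m : List P) :
    leftTail q (l ++ m) = leftTail q l ++ leftTail (lastOf q (leftTail q l)) m := by
  induction l generalizing q with
  | nil => rfl
  | cons p l ih => simp [leftTail, lastOf, ih]

theorem rightList_append (q p : P) (l m : List P) :
    rightList q p (l ++ m) =
      ((rightList (rightList q (lastOf p l) m).1 p l).1,
        (rightList (rightList q (lastOf p l) m).1 p l).2 ++ (rightList q (lastOf p l) m).2) := by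
  induction l generalizing p with
  | nil => rfl
  | cons p' l ih => simp [rightList, lastOf, ih]

section
variable [IsStrongProjectionAlgebra P]

theorem isChain_leftTail {p q : P} {l : List P} (h : (p :: l).IsChain Frel) (hq : Le q p) :
    (q :: leftTail q l).IsChain Frel := by
  induction l generalizing p q with
  | nil => simp [leftTail]
  | cons p' l ih =>
    rw [List.isChain_cons_cons] at h
    rw [leftTail, List.isChain_cons_cons]
    exact ⟨h.1.restrict_left hq, ih h.2 (star_le q p')⟩

theorem rightList_le {p q : P} {l : List P} (hq : Le q (lastOf p l)) :
    Le (rightList q p l).1 p := by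
  cases l with
  | nil => exact hq
  | cons p' l => exact times_le _ _

theorem isChain_rightList {p q : P} {l : List P} (h : (p :: l).IsChain Frel)
    (hq : Le q (lastOf p l)) :
    ((rightList q p l).1 :: (rightList q p l).2).IsChain Frel := by
  induction l generalizing p with
  | nil => simp [rightList]
  | cons p' l ih =>
    rw [List.isChain_cons_cons] at h
    rw [rightList, List.isChain_cons_cons]
    exact ⟨h.1.restrict_right (rightList_le (l := l) hq), ih h.2 hq⟩

/-- The left restriction of `𝔭` to `q ≤ d(𝔭)`. -/
def leftRestrict (q : P) (a : PPath P) (h : Le q a.dom) : PPath P :=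
  ⟨q, leftTail q a.tail, isChain_leftTail a.chain h⟩

/-- The right restriction of `𝔭` to `q ≤ r(𝔭)`. -/
def rightRestrict (a : PPath P) (q : P) (h : Le q a.ran) : PPath P :=
  ⟨(rightList q a.head a.tail).1, (rightList q a.head a.tail).2, isChain_rightList a.chain h⟩

@[simp] theorem dom_leftRestrict (q : P) (a : PPath P) (h : Le q a.dom) :
    (leftRestrict q a h).dom = q := rfl

@[simp] theorem ran_rightRestrict (a : PPath P) (q : P) (h : Le q a.ran) :
    (rightRestrict a q h).ran = q := lastOf_rightList q a.head a.tail

theorem dom_rightRestrict_le (a : PPath P) (q : P) (h : Le q a.ran) :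
    Le (rightRestrict a q h).dom a.dom := rightList_le h

theorem lastOf_leftTail_le {p q : P} {l : List P} (hq : Le q p) :
    Le (lastOf q (leftTail q l)) (lastOf p l) := by
  induction l generalizing p q with
  | nil => exact hq
  | cons p' l ih => exact ih (star_le q p')

theorem ran_leftRestrict_le (q : P) (a : PPath P) (h : Le q a.dom) :
    Le (leftRestrict q a h).ran a.ran := lastOf_leftTail_le h

theorem leftRestrict_comp (q : P) (a b : PPath P) (h : a.ran = b.dom) (hq : Le q a.dom) :
    leftRestrict q (a.comp b h) hq =
      (leftRestrict q a hq).comp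
        (leftRestrict (leftRestrict q a hq).ran b (h ▸ ran_leftRestrict_le q a hq)) rfl := by
  ext1
  · rfl
  · exact leftTail_append q a.tail b.tail

theorem rightRestrict_comp (q : P) (a b : PPath P) (h : a.ran = b.dom) (hq : Le q b.ran) :
    rightRestrict (a.comp b h) q (by rw [ran_comp]; exact hq) =
      (rightRestrict a (rightRestrict b q hq).dom (h ▸ dom_rightRestrict_le b q hq)).comp
        (rightRestrict b q hq) (by simp) := by
  have h' : lastOf a.head a.tail = b.head := h
  ext1
  · simp [rightRestrict, comp, rightList_append, h', dom]
  · simp [rightRestrict, comp, rightList_append, h', dom]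

end

end PPath

section Congruence

variable {P : Type*} [ProjectionOps P] [IsStrongProjectionAlgebra P]

/-- The congruence on the path category generated by the pairs `((p, p), (p))` and
`((e, e ⋆ p, f), (e, p × f, f))`, where `(e, p, f)` is an admissible triple. -/
inductive ChainCongr : PPath P → PPath P → Prop
  | loop (p : P) : ChainCongr (PPath.pair p p (frel_self p)) (PPath.single p)
  | adm (e p f : P) (h : Admissible e p f) :
      ChainCongr (PPath.triple e (e ⋆ₚ p) f h.frel.1 h.frel.2.1)
        (PPath.triple e (p ×ₚ f) f h.frel.2.2.1 h.frel.2.2.2)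
  | refl (a : PPath P) : ChainCongr a a
  | symm {a b : PPath P} : ChainCongr a b → ChainCongr b a
  | trans {a b c : PPath P} : ChainCongr a b → ChainCongr b c → ChainCongr a c
  | comp_left (u : PPath P) {a b : PPath P} (ha : u.ran = a.dom) (hb : u.ran = b.dom) :
      ChainCongr a b → ChainCongr (u.comp a ha) (u.comp b hb)
  | comp_right {a b : PPath P} (v : PPath P) (ha : a.ran = v.dom) (hb : b.ran = v.dom) :
      ChainCongr a b → ChainCongr (a.comp v ha) (b.comp v hb)

namespace ChainCongr

open PPath IsProjectionAlgebra

theorem dom_eq {a b : PPath P} (h : ChainCongr a b) : a.dom = b.dom := by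
  induction h with
  | loop p => rfl
  | adm e p f h => rfl
  | refl a => rfl
  | symm _ ih => exact ih.symm
  | trans _ _ ih₁ ih₂ => exact ih₁.trans ih₂
  | comp_left u ha hb _ ih => rfl
  | comp_right v ha hb _ ih => exact ih

theorem ran_eq {a b : PPath P} (h : ChainCongr a b) : a.ran = b.ran := by
  induction h with
  | loop p => rfl
  | adm e p f h => rfl
  | refl a => rfl
  | symm _ ih => exact ih.symm
  | trans _ _ ih₁ ih₂ => exact ih₁.trans ih₂
  | comp_left u ha hb _ ih => rw [ran_comp, ran_comp, ih]
  | comp_right v ha hb _ ih => rw [ran_comp, ran_comp]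

theorem comp_congr {a b u v : PPath P} (h : ChainCongr a b) (h' : ChainCongr u v)
    (hau : a.ran = u.dom) (hbv : b.ran = v.dom) :
    ChainCongr (a.comp u hau) (b.comp v hbv) :=
  (comp_right u hau (h.ran_eq ▸ hau) h).trans (comp_left b (h.ran_eq ▸ hau) hbv h')

theorem leftRestrict_congr {a b : PPath P} (h : ChainCongr a b) (q : P) (ha : Le q a.dom)
    (hb : Le q b.dom) : ChainCongr (leftRestrict q a ha) (leftRestrict q b hb) := by
  induction h generalizing q with
  | loop p =>
    have h1 : q ⋆ₚ p = q := Le.star_right ha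
    convert loop q using 1
    · ext1
      · rfl
      · simp [leftRestrict, leftTail, pair, h1]
    · rfl
  | adm e p f h =>
    have hq : Le q e := ha
    have h1 : q ⋆ₚ (e ⋆ₚ p) = q ⋆ₚ p := by rw [R4, (star_mono p hq).star_right]
    have h2 : q ⋆ₚ (p ×ₚ f) = p ×ₚ ((q ⋆ₚ p) ⋆ₚ f) := star_times_eq f p q
    have h3 : (p ×ₚ ((q ⋆ₚ p) ⋆ₚ f)) ⋆ₚ f = (q ⋆ₚ p) ⋆ₚ f := by rw [← h2, P3_star]
    have hadm : Admissible q p ((q ⋆ₚ p) ⋆ₚ f) := by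
      refine ⟨(star_star_self _ _).symm, ?_⟩
      rw [← h2, times_star_left]
      have := L4 e q (p ×ₚ f)
      rw [hq.times_left, ← h.2, hq.times_right] at this
      exact this.symm
    convert adm q p _ hadm using 1
    · ext1
      · rfl
      · simp [leftRestrict, leftTail, triple, h1]
    · ext1
      · rfl
      · simp [leftRestrict, leftTail, triple, h2, h3]
  | refl a => exact refl _
  | symm _ ih => exact (ih q hb ha).symm
  | trans h₁ _ ih₁ ih₂ =>
    exact (ih₁ q ha (h₁.dom_eq ▸ ha)).trans (ih₂ q (h₁.dom_eq ▸ ha) hb)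
  | @comp_left u a b ha' hb' h ih =>
    rw [leftRestrict_comp q u a ha' ha, leftRestrict_comp q u b hb' ha]
    exact comp_left _ _ _ (ih _ _ _)
  | @comp_right a b v ha' hb' h ih =>
    rw [leftRestrict_comp q a v ha' ha, leftRestrict_comp q b v hb' hb]
    have h1 := ih q ha hb
    refine comp_congr h1 ?_ _ _
    have h2 := h1.ran_eq
    have : ∀ (r s : P) (hr : Le r v.dom) (hs : Le s v.dom), r = s →
        ChainCongr (leftRestrict r v hr) (leftRestrict s v hs) := by
      rintro r s hr hs rfl
      exact refl _
    exact this _ _ _ _ h2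

theorem rightRestrict_congr {a b : PPath P} (h : ChainCongr a b) (q : P) (ha : Le q a.ran)
    (hb : Le q b.ran) : ChainCongr (rightRestrict a q ha) (rightRestrict b q hb) := by
  induction h generalizing q with
  | loop p =>
    have h1 : p ×ₚ q = q := Le.times_left ha
    convert loop q using 1
    · ext1 <;> simp [rightRestrict, rightList, pair, h1]
    · rfl
  | adm e p f h =>
    have hq : Le q f := ha
    have h1 : (p ×ₚ f) ×ₚ q = p ×ₚ q := by rw [L4, (times_mono p hq).times_left]
    have h2 : (e ⋆ₚ p) ×ₚ q = (e ×ₚ (p ×ₚ q)) ⋆ₚ p := star_times e p q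
    have h3 : e ×ₚ ((e ×ₚ (p ×ₚ q)) ⋆ₚ p) = e ×ₚ (p ×ₚ q) := by rw [← h2, P3_times]
    have hadm : Admissible (e ×ₚ (p ×ₚ q)) p q := by
      refine ⟨?_, (times_times_self _ _).symm⟩
      rw [← h2, times_star_right]
      have := R4 f q (e ⋆ₚ p)
      rw [hq.star_right, ← h.1, hq.star_left] at this
      exact this.symm
    convert adm _ p q hadm using 1
    · ext1 <;> simp [rightRestrict, rightList, triple, h2, h3]
    · ext1 <;> simp [rightRestrict, rightList, triple, h1]
  | refl a => exact refl _
  | symm _ ih => exact (ih q hb ha).symm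
  | trans h₁ _ ih₁ ih₂ =>
    exact (ih₁ q ha (h₁.ran_eq ▸ ha)).trans (ih₂ q (h₁.ran_eq ▸ ha) hb)
  | @comp_left u a b ha' hb' h ih =>
    rw [ran_comp] at ha hb
    rw [rightRestrict_comp q u a ha' ha, rightRestrict_comp q u b hb' hb]
    have h1 := ih q ha hb
    refine comp_congr ?_ h1 _ _
    have h2 := h1.dom_eq
    have : ∀ (r s : P) (hr : Le r u.ran) (hs : Le s u.ran), r = s →
        ChainCongr (rightRestrict u r hr) (rightRestrict u s hs) := by
      rintro r s hr hs rfl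
      exact refl _
    exact this _ _ _ _ h2
  | @comp_right a b v ha' hb' h ih =>
    rw [ran_comp] at ha
    rw [rightRestrict_comp q a v ha' ha, rightRestrict_comp q b v hb' ha]
    exact comp_right _ _ _ (ih _ _ _)

end ChainCongr

variable (P) in
/-- The congruence `≈_P` as a setoid. -/
def chainSetoid : Setoid (PPath P) :=
  ⟨ChainCongr, ChainCongr.refl, ChainCongr.symm, ChainCongr.trans⟩

variable (P) in
/-- The underlying set `𝒫(P)/≈_P` of the chain category `𝒞(P)`, and hence of the chain
semigroup `S(𝒞(P))`. -/
def ChainSemigroup : Type _ := Quotient (chainSetoid P)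

open PPath IsProjectionAlgebra

/-- On paths, `𝔭 ∙ 𝔮 = 𝔭⇂_{r(𝔭) × d(𝔮)} ∘ (r(𝔭) × d(𝔮), r(𝔭) ⋆ d(𝔮)) ∘ _{r(𝔭) ⋆ d(𝔮)}⇃𝔮`. -/
def PPath.bullet (a b : PPath P) : PPath P :=
  ((rightRestrict a (a.ran ×ₚ b.dom) (times_le _ _)).comp
    (pair (a.ran ×ₚ b.dom) (a.ran ⋆ₚ b.dom) (frel_times_star _ _))
      (ran_rightRestrict _ _ _)).comp
    (leftRestrict (a.ran ⋆ₚ b.dom) b (star_le _ _)) (ran_comp _ _ _)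

theorem ChainCongr.bullet_congr {a a' b b' : PPath P} (ha : ChainCongr a a')
    (hb : ChainCongr b b') : ChainCongr (a.bullet b) (a'.bullet b') := by
  have key : ∀ (s t s' t' : P) (h : Frel s t) (h' : Frel s' t') (hs : Le s a.ran)
      (hs' : Le s' a'.ran) (ht : Le t b.dom) (ht' : Le t' b'.dom), s = s' → t = t' →
      ChainCongr
        (((rightRestrict a s hs).comp (pair s t h) (ran_rightRestrict _ _ _)).comp
          (leftRestrict t b ht) (ran_comp _ _ _))
        (((rightRestrict a' s' hs').comp (pair s' t' h') (ran_rightRestrict _ _ _)).comp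
          (leftRestrict t' b' ht') (ran_comp _ _ _)) := by
    rintro s t _ _ h h' hs hs' ht ht' rfl rfl
    exact comp_congr (comp_right _ _ _ (ha.rightRestrict_congr s hs hs'))
      (hb.leftRestrict_congr t ht ht') _ _
  exact key _ _ _ _ _ _ _ _ _ _ (by rw [ha.ran_eq, hb.dom_eq]) (by rw [ha.ran_eq, hb.dom_eq])

namespace ChainSemigroup

/-- The class `[p₁, …, p_k]` of a path. -/
def mk (a : PPath P) : ChainSemigroup P := Quotient.mk (chainSetoid P) a

/-- The operations of the chain semigroup: `[𝔭] ∙ [𝔮] = [𝔭 ∙ 𝔮]`, `[𝔭]⁺ = [d(𝔭)]`,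
`[𝔭]* = [r(𝔭)]`. -/
instance : BiUnary (ChainSemigroup P) where
  mul := Quotient.map₂ PPath.bullet (fun _ _ ha _ _ hb => ChainCongr.bullet_congr ha hb)
  plus := Quotient.lift (fun a => mk (single a.dom))
    (fun _ _ h => congrArg (fun p => mk (single p)) (ChainCongr.dom_eq h))
  ast := Quotient.lift (fun a => mk (single a.ran))
    (fun _ _ h => congrArg (fun p => mk (single p)) (ChainCongr.ran_eq h))

end ChainSemigroup

end Congruence

/-- For a map `φ : P → P(S)` and a path `(p₁, …, p_k)`, the product
`(p₁φ)(p₂φ)⋯(p_kφ)` in `S`. -/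
def PPath.prod {P S : Type*} [ProjectionOps P] [BiUnary S] (φ : P → Projections S)
    (a : PPath P) : S :=
  a.tail.foldl (fun s p => s * (φ p).1) (φ a.head).1

end ProjectionAlgebra

/-! The classes `[p]` generate the chain semigroup, because consecutive entries of a path are
`F`-related and multiplying them restricts nothing (`mk_cons`). This gives uniqueness at once
(`hom_ext`). It also reduces associativity to the case where the middle factor is a single `[q]`,
because the middle elements that associate are closed under products. In that case the two
bracketings differ only in a three-term segment, and the two segments are the two sides of an
admissible-triple generator of `≈_P` (`bullet_single_assoc`).

The ample laws hold because left and right restriction are mutually inverse: a left restriction is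
the right restriction to its own range, and dually. This is where strongness of `P` enters.

For existence, multiply images along a path. In `S`, projections satisfy `(ef)⁺f = ef = e(ef)*`.
Hence both sides of an admissible generator evaluate to `(eφ)(pφ)(fφ)`, restricting a path
multiplies its product by the image of the restricting projection, and the product map is
multiplicative (`prod_congr`, `prod_bullet`). -/

namespace ProjectionAlgebra

open IsProjectionAlgebra

/-! ### Restrictions of paths: identity, transitivity, mutual inverses. -/

namespace PPath

variable {P : Type*} [ProjectionOps P]

theorem rightList_self {p : P} {l : List P} (h : (p :: l).IsChain Frel) :
    rightList (lastOf p l) p l = (p, l) := by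
  induction l generalizing p with
  | nil => rfl
  | cons p' l ih =>
    rw [List.isChain_cons_cons] at h
    rw [rightList, lastOf, ih h.2, h.1.1]

theorem leftTail_self {p : P} {l : List P} (h : (p :: l).IsChain Frel) : leftTail p l = l := by
  induction l generalizing p with
  | nil => rfl
  | cons p' l ih =>
    rw [List.isChain_cons_cons] at h
    rw [leftTail, h.1.2, ih h.2]

variable [IsStrongProjectionAlgebra P]

/-- Restriction is transitive: `L4` gives `(p × q') × u' = (p × q') × (p × u')`, and `p × u' ≤ p ×
q'` by monotonicity when `u' ≤ q'`. -/
theorem rightList_rightList {u q : P} (h : Le u q) (p : P) (l : List P) :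
    rightList u (rightList q p l).1 (rightList q p l).2 = rightList u p l := by
  induction l generalizing p with
  | nil => rfl
  | cons p' l ih =>
    have h1 : Le (rightList u p' l).1 (rightList q p' l).1 := by
      rw [← ih p']
      exact rightList_le (by rwa [lastOf_rightList])
    simp only [rightList, ih p']
    rw [L4, (times_mono p h1).times_left]

theorem leftTail_leftTail {u q : P} (h : Le u q) (l : List P) :
    leftTail u (leftTail q l) = leftTail u l := by
  induction l generalizing u q with
  | nil => rfl
  | cons p l ih =>
    have h1 : u ⋆ₚ (q ⋆ₚ p) = u ⋆ₚ p := by rw [R4, (star_mono p h).star_right]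
    simp only [leftTail, h1, ih (star_mono p h)]

/-- Strongness lets each step be undone: for `p F p'` and `q ≤ p`, `p × (q ⋆ p') = q`, so
restricting back from the range recovers every entry. -/
theorem rightList_lastOf_leftTail {p q : P} {l : List P} (h : (p :: l).IsChain Frel)
    (hq : Le q p) : rightList (lastOf q (leftTail q l)) p l = (q, leftTail q l) := by
  induction l generalizing p q with
  | nil => rfl
  | cons p' l ih =>
    rw [List.isChain_cons_cons] at h
    have h1 : p ×ₚ (q ⋆ₚ p') = q := strong_times (by rw [h.1.1]; exact hq)
    simp only [leftTail, rightList, lastOf, ih h.2 (star_le q p'), h1]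

theorem leftTail_rightList {p q : P} {l : List P} (h : (p :: l).IsChain Frel)
    (hq : Le q (lastOf p l)) : leftTail (rightList q p l).1 l = (rightList q p l).2 := by
  induction l generalizing p with
  | nil => rfl
  | cons p' l ih =>
    rw [List.isChain_cons_cons] at h
    have h1 : (p ×ₚ (rightList q p' l).1) ⋆ₚ p' = (rightList q p' l).1 :=
      strong_star (by rw [h.1.2]; exact rightList_le hq)
    simp only [leftTail, rightList, h1, ih h.2 hq]

theorem rightRestrict_ran (a : PPath P) (h : Le a.ran a.ran) : rightRestrict a a.ran h = a := by
  have := rightList_self a.chain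
  ext1
  · exact congrArg Prod.fst this
  · exact congrArg Prod.snd this

theorem leftRestrict_dom (a : PPath P) (h : Le a.dom a.dom) : leftRestrict a.dom a h = a := by
  ext1
  · rfl
  · exact leftTail_self a.chain

/-- A left restriction is the right restriction to its range. -/
theorem rightRestrict_ran_leftRestrict (a : PPath P) {q : P} (h : Le q a.dom) :
    rightRestrict a (leftRestrict q a h).ran (ran_leftRestrict_le q a h) =
      leftRestrict q a h := by
  have := rightList_lastOf_leftTail a.chain h
  ext1
  · exact congrArg Prod.fst this
  · exact congrArg Prod.snd this

/-- A right restriction is the left restriction to its domain. -/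
theorem leftRestrict_dom_rightRestrict (a : PPath P) {q : P} (h : Le q a.ran) :
    leftRestrict (rightRestrict a q h).dom a (dom_rightRestrict_le a q h) =
      rightRestrict a q h := by
  ext1
  · rfl
  · exact leftTail_rightList a.chain h

/-! ### Products of paths up to the congruence. -/

/-- The path `𝔭⇂_s ∘ (s, t) ∘ _t⇃𝔮`. -/
def link (a b : PPath P) (s t : P) (h : Frel s t) (hs : Le s a.ran) (ht : Le t b.dom) :
    PPath P :=
  ((rightRestrict a s hs).comp (pair s t h) (ran_rightRestrict _ _ _)).comp
    (leftRestrict t b ht) (ran_comp _ _ _)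

theorem bullet_eq_link {a b : PPath P} {s t : P} (hs : a.ran ×ₚ b.dom = s)
    (ht : a.ran ⋆ₚ b.dom = t) :
    a.bullet b = link a b s t (by subst hs ht; exact frel_times_star _ _)
      (by subst hs; exact times_le _ _) (by subst ht; exact star_le _ _) := by
  subst hs ht
  rfl

theorem ran_bullet (a b : PPath P) :
    (a.bullet b).ran = (leftRestrict (a.ran ⋆ₚ b.dom) b (star_le _ _)).ran := ran_comp _ _ _

theorem comp_pair_self (a : PPath P) {p : P} (h : a.ran = p) :
    ChainCongr (a.comp (pair p p (frel_self p)) h) a := by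
  have h1 := ChainCongr.comp_left a (a := pair p p (frel_self p)) (b := single p) h h
    (ChainCongr.loop p)
  have h2 : a.comp (single p) h = a := by
    ext1
    · rfl
    · exact List.append_nil _
  rwa [h2] at h1

theorem pair_self_comp (a : PPath P) {p : P} (h : p = a.dom) :
    ChainCongr ((pair p p (frel_self p)).comp a h) a := by
  have h1 := ChainCongr.comp_right (a := pair p p (frel_self p)) (b := single p) a h h
    (ChainCongr.loop p)
  have h2 : (single p).comp a h = a := by
    ext1
    · exact h
    · rfl
  rwa [h2] at h1

/-- For `q` below the range, the linking pair is the loop `(q, q)`, which the congruence removes. -/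
theorem bullet_single_of_le (a : PPath P) {q : P} (h : Le q a.ran) :
    ChainCongr (a.bullet (single q)) (rightRestrict a q h) := by
  rw [bullet_eq_link (s := q) (t := q) h.times_left h.star_left]
  have : link a (single q) q q (frel_self q) h (Le.refl q) =
      (rightRestrict a q h).comp (pair q q (frel_self q)) (ran_rightRestrict _ _ _) := by
    ext1
    · rfl
    · exact List.append_nil _
  rw [this]
  exact comp_pair_self _ _

theorem single_bullet_of_le (a : PPath P) {q : P} (h : Le q a.dom) :
    ChainCongr ((single q).bullet a) (leftRestrict q a h) := by
  rw [bullet_eq_link (a := single q) (b := a) h.times_right h.star_right]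
  exact pair_self_comp (leftRestrict q a h) rfl

/-- With `e = p × (q × s)` and `f = (p ⋆ q) ⋆ s`, both bracketings restrict `a` to `e` and `c` to
`f`. The left one joins them by `(e, e ⋆ q, f)`, the right one by `(e, q × f, f)`. -/
theorem bullet_single_assoc (a c : PPath P) (q : P) :
    ChainCongr ((a.bullet (single q)).bullet c) (a.bullet ((single q).bullet c)) := by
  obtain ⟨p, hp⟩ : ∃ p, a.ran = p := ⟨_, rfl⟩
  obtain ⟨s, hs⟩ : ∃ s, c.dom = s := ⟨_, rfl⟩
  -- The strong identities give `e ⋆ q = (p ⋆ q) × s` and `q × f = p ⋆ (q × s)`, so both conditions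
  -- are instances of `x × y F x ⋆ y`.
  have hadm : Admissible (p ×ₚ (q ×ₚ s)) q ((p ⋆ₚ q) ⋆ₚ s) := by
    constructor
    · rw [← star_times]
      exact (frel_times_star _ _).2.symm
    · rw [← star_times_eq]
      exact (frel_times_star _ _).1.symm
  have he : Le (p ×ₚ (q ×ₚ s)) (p ×ₚ q) := times_mono p (times_le q s)
  have hf : Le ((p ⋆ₚ q) ⋆ₚ s) (q ⋆ₚ s) := star_mono s (star_le p q)
  have he' : Le (p ×ₚ (q ×ₚ s)) a.ran := hp ▸ times_le _ _
  have hf' : Le ((p ⋆ₚ q) ⋆ₚ s) c.dom := hs ▸ star_le _ _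
  -- Each outer product restricts the inner one a second time; `h1` and `h2` say that the entries `p
  -- × q` and `q ⋆ s` then become `e` and `f`.
  have h1 : (p ×ₚ q) ×ₚ ((p ⋆ₚ q) ×ₚ s) = p ×ₚ (q ×ₚ s) := by
    rw [← P3_times s q p, L3 p (p ⋆ₚ q) s, times_star_left]
  have h2 : (p ⋆ₚ (q ×ₚ s)) ⋆ₚ (q ⋆ₚ s) = (p ⋆ₚ q) ⋆ₚ s := by
    rw [← P3_star p q s, R3 s (q ×ₚ s) p, times_star_right]
  have h3 := rightList_rightList he a.head a.tail
  have h4 := leftTail_leftTail hf c.tail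
  have hl : (a.bullet (single q)).bullet c =
      ((rightRestrict a _ he').comp (triple _ _ _ hadm.frel.1 hadm.frel.2.1)
        (ran_rightRestrict _ _ _)).comp (leftRestrict _ c hf') (ran_comp _ _ _) := by
    have hr : (a.bullet (single q)).ran = p ⋆ₚ q := by rw [ran_bullet, hp]; rfl
    have hw := star_times p q s
    rw [bullet_eq_link (s := (p ⋆ₚ q) ×ₚ s) (t := (p ⋆ₚ q) ⋆ₚ s) (by rw [hr, hs])
      (by rw [hr, hs])]
    ext1 <;> simp [link, bullet, comp, rightRestrict, leftRestrict, pair, triple, single,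
      rightList_append, rightList, lastOf_rightList, leftTail, hp, h1, h3, ← hw, dom]
  have hr : a.bullet ((single q).bullet c) =
      ((rightRestrict a _ he').comp (triple _ _ _ hadm.frel.2.2.1 hadm.frel.2.2.2)
        (ran_rightRestrict _ _ _)).comp (leftRestrict _ c hf') (ran_comp _ _ _) := by
    have hd : ((single q).bullet c).dom = q ×ₚ s := by rw [← hs]; rfl
    have hw := star_times_eq s q p
    rw [bullet_eq_link (s := p ×ₚ (q ×ₚ s)) (t := p ⋆ₚ (q ×ₚ s)) (by rw [hd, hp])
      (by rw [hd, hp])]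
    have hs' : c.head = s := hs
    ext1 <;> simp [link, bullet, comp, rightRestrict, leftRestrict, pair, triple, single,
      rightList, leftTail, hs', h2, h4, ← hw, dom, ran, lastOf]
  rw [hl, hr]
  exact ChainCongr.comp_right _ _ _ (ChainCongr.comp_left _ _ _ (ChainCongr.adm _ _ _ hadm))

end PPath

/-! ### The chain semigroup is a DRC-restriction semigroup. -/

namespace ChainSemigroup

open PPath

variable {P : Type*} [ProjectionOps P] [IsStrongProjectionAlgebra P]

theorem mk_eq {a b : PPath P} (h : ChainCongr a b) : mk a = mk b := Quotient.sound h

theorem mk_mul (a b : PPath P) : mk a * mk b = mk (a.bullet b) := rfl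

/-- Since `p F q`, the linking pair is `(p, q)` itself and the remaining path is restricted to its
own domain. -/
theorem mk_cons {p q : P} {l : List P} (h : (p :: q :: l).IsChain Frel) :
    mk ⟨p, q :: l, h⟩ = mk (single p) * mk ⟨q, l, (List.isChain_cons_cons.1 h).2⟩ := by
  have h' := List.isChain_cons_cons.1 h
  rw [mk_mul, bullet_eq_link (a := single p) (b := ⟨q, l, h'.2⟩) h'.1.1 h'.1.2]
  congr 1
  ext1
  · rfl
  · exact congrArg (q :: ·) (leftTail_self h'.2).symm

@[elab_as_elim]
theorem induction_on {motive : ChainSemigroup P → Prop} (x : ChainSemigroup P)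
    (single : ∀ p, motive (mk (single p)))
    (mul : ∀ p x, motive x → motive (mk (PPath.single p) * x)) : motive x := by
  induction x using Quotient.inductionOn with
  | h a =>
    obtain ⟨p, l, h⟩ := a
    change motive (mk ⟨p, l, h⟩)
    induction l generalizing p with
    | nil => exact single p
    | cons q l ih =>
      rw [mk_cons]
      exact mul _ _ (ih _ _)

protected theorem mul_assoc (x y z : ChainSemigroup P) : (x * y) * z = x * (y * z) := by
  have base : ∀ (p : P) (x z : ChainSemigroup P),
      (x * mk (single p)) * z = x * (mk (single p) * z) := by
    intro p x z
    induction x, z using Quotient.inductionOn₂ with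
    | h a c => exact mk_eq (bullet_single_assoc a c p)
  induction y using induction_on generalizing x z with
  | single p => exact base p x z
  -- `(x(py))z = ((xp)y)z = (xp)(yz) = x(p(yz)) = x((py)z)`; the induction hypothesis is needed for
  -- all outer factors.
  | mul p y ih => rw [← base, ih, base, ih]

theorem mul_single_of_le (a : PPath P) {q : P} (h : Le q a.ran) :
    mk a * mk (single q) = mk (rightRestrict a q h) := mk_eq (bullet_single_of_le a h)

theorem single_mul_of_le (a : PPath P) {q : P} (h : Le q a.dom) :
    mk (single q) * mk a = mk (leftRestrict q a h) := mk_eq (single_bullet_of_le a h)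

theorem single_mul_single_mul_single {p q : P} (h : Le q p) :
    mk (single p) * mk (single q) * mk (single p) = mk (single q) := by
  rw [mul_single_of_le (single p) (q := q) h]
  exact single_mul_of_le (single p) (q := q) h

theorem hom_ext {S : Type*} [BiUnary S] {f g : BiUnaryHom (ChainSemigroup P) S}
    (h : ∀ p : P, f (mk (PPath.single p)) = g (mk (PPath.single p))) : f = g := by
  ext x
  induction x using induction_on with
  | single p => exact h p
  | mul p x ih => rw [f.map_mul, g.map_mul, ih, h p]

instance : IsDRCRestriction (ChainSemigroup P) where
  assoc := ChainSemigroup.mul_assoc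
  i x := by
    induction x using Quotient.inductionOn with
    | h a => exact (single_mul_of_le a (Le.refl _)).trans (by rw [leftRestrict_dom]; rfl)
  i' x := by
    induction x using Quotient.inductionOn with
    | h a => exact (mul_single_of_le a (Le.refl _)).trans (by rw [rightRestrict_ran]; rfl)
  ii x y := by
    induction x, y using Quotient.inductionOn₂ with
    | h a b => rfl
  ii' x y := by
    induction x, y using Quotient.inductionOn₂ with
    | h a b =>
      change mk (single (a.bullet b).ran) = mk (single ((single a.ran).bullet b).ran)
      rw [ran_bullet, ran_bullet]
      rfl
  iii x y := by
    induction x, y using Quotient.inductionOn₂ with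
    | h a b =>
      exact (single_mul_single_mul_single (dom_rightRestrict_le a _ (times_le a.ran b.dom))).symm
  iii' x y := by
    induction x, y using Quotient.inductionOn₂ with
    | h a b =>
      refine (single_mul_single_mul_single ?_).symm
      rw [ran_bullet]
      exact ran_leftRestrict_le _ _ _
  iv x := by
    induction x using Quotient.inductionOn with
    | h a => rfl
  iv' x := by
    induction x using Quotient.inductionOn with
    | h a => rfl
  v x := by
    induction x using Quotient.inductionOn with
    | h a => rfl
  v' x := by
    induction x using Quotient.inductionOn with
    | h a => rfl
  vi x y := by
    induction x, y using Quotient.inductionOn₂ with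
    | h a b =>
      change mk a * mk (single (b.bullet a).ran) =
        mk (single (b.bullet (single a.dom)).ran) * mk a
      have h : (b.bullet (single a.dom)).ran = b.ran ⋆ₚ a.dom := ran_bullet _ _
      -- Both sides are restrictions of `a`: the right side to the domain `r(b) ⋆ d(a)`, the left
      -- side to the range of that same restriction.
      rw [ran_bullet, h, mul_single_of_le a (ran_leftRestrict_le _ _ _),
        single_mul_of_le a (star_le _ _), rightRestrict_ran_leftRestrict]
  vi' x y := by
    induction x, y using Quotient.inductionOn₂ with
    | h a b =>
      change mk (single (rightRestrict a (a.ran ×ₚ b.dom) (times_le _ _)).dom) * mk a =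
        mk a * mk (single (a.ran ×ₚ b.dom))
      rw [mul_single_of_le a (times_le _ _), single_mul_of_le a (dom_rightRestrict_le _ _ _),
        leftRestrict_dom_rightRestrict]

end ChainSemigroup

/-! ### Arithmetic of projections in `S`. -/

namespace Projections

variable {S : Type*} [BiUnary S] [IsDRCRestriction S]

open IsDRCRestriction

theorem plus_val (e : Projections S) : BiUnary.plus e.1 = e.1 := by
  obtain ⟨_, x, rfl⟩ := e
  exact iv x

theorem ast_val (e : Projections S) : BiUnary.ast e.1 = e.1 := by
  obtain ⟨_, x, rfl⟩ := e
  exact v x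

theorem val_mul_self (e : Projections S) : e.1 * e.1 = e.1 := by
  have := i e.1
  rwa [plus_val] at this

/-- By `iii`, `(ef)⁺` absorbs `e` on its right, so `(ef)⁺f = (ef)⁺ef = ef`. -/
theorem times_val_mul (e f : Projections S) : (e ×ₚ f).1 * f.1 = e.1 * f.1 := by
  change BiUnary.plus (e.1 * f.1) * f.1 = e.1 * f.1
  have h1 : BiUnary.plus (e.1 * f.1) * e.1 = BiUnary.plus (e.1 * f.1) := by
    rw [iii, plus_val, assoc, assoc, val_mul_self, assoc]
  rw [← h1, assoc, i]

theorem mul_star_val (e f : Projections S) : e.1 * (e ⋆ₚ f).1 = e.1 * f.1 := by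
  change e.1 * BiUnary.ast (e.1 * f.1) = e.1 * f.1
  have h1 : f.1 * BiUnary.ast (e.1 * f.1) = BiUnary.ast (e.1 * f.1) := by
    rw [iii', ast_val, ← assoc, ← assoc, val_mul_self]
  rw [← h1, ← assoc, i']

end Projections

/-! ### Evaluating paths in `S`. -/

namespace PPath

open IsDRCRestriction Projections

theorem foldl_mul {P S : Type*} [BiUnary S] [IsDRCRestriction S]
    (φ : P → Projections S) (x y : S) (l : List P) :
    l.foldl (fun s p => s * (φ p).1) (x * y) = x * l.foldl (fun s p => s * (φ p).1) y := by
  induction l generalizing y with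
  | nil => rfl
  | cons p l ih => rw [List.foldl_cons, List.foldl_cons, assoc, ih]

variable {P S : Type*} [ProjectionOps P] [BiUnary S] [IsDRCRestriction S]

theorem prod_cons (φ : P → Projections S) {p q : P} {l : List P}
    (h : (p :: q :: l).IsChain Frel) :
    prod φ ⟨p, q :: l, h⟩ = (φ p).1 * prod φ ⟨q, l, (List.isChain_cons_cons.1 h).2⟩ :=
  foldl_mul φ (φ p).1 (φ q).1 l

theorem val_mul_prod (φ : P → Projections S) (a : PPath P) :
    (φ a.dom).1 * prod φ a = prod φ a :=
  (foldl_mul φ _ _ _).symm.trans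
    (congrArg (fun x => a.tail.foldl (fun s p => s * (φ p).1) x) (val_mul_self (φ a.head)))

/-- Composition lists the shared endpoint once, the product of values twice; idempotency absorbs the
difference. -/
theorem prod_comp (φ : P → Projections S) (a b : PPath P) (h : a.ran = b.dom) :
    prod φ (a.comp b h) = prod φ a * prod φ b := by
  obtain ⟨p, l, ha⟩ := a
  induction l generalizing p with
  | nil =>
    obtain rfl : p = b.dom := h
    exact (val_mul_prod φ b).symm
  | cons q l ih =>
    have := ih q (List.isChain_cons_cons.1 ha).2 h
    rw [prod_cons, assoc, ← this]
    exact foldl_mul φ (φ p).1 (φ q).1 (l ++ b.tail)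

variable (φ : ProjectionHom P (Projections S))

theorem map_times_mul (p q : P) : (φ (p ×ₚ q)).1 * (φ q).1 = (φ p).1 * (φ q).1 := by
  rw [φ.map_times, times_val_mul]

theorem mul_map_star (p q : P) : (φ p).1 * (φ (p ⋆ₚ q)).1 = (φ p).1 * (φ q).1 := by
  rw [φ.map_star, mul_star_val]

theorem map_mul_map_of_le {p q : P} (h : Le q p) : (φ p).1 * (φ q).1 = (φ q).1 := by
  have := map_times_mul φ p q
  rw [h.times_left, val_mul_self] at this
  exact this.symm

theorem map_mul_map_of_ge [IsProjectionAlgebra P] {p q : P} (h : Le q p) :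
    (φ q).1 * (φ p).1 = (φ q).1 := by
  have := mul_map_star φ q p
  rw [h.star_right, val_mul_self] at this
  exact this.symm

theorem plus_prod (a : PPath P) : BiUnary.plus (prod φ a) = (φ a.dom).1 := by
  obtain ⟨p, l, h⟩ := a
  induction l generalizing p with
  | nil => exact plus_val _
  | cons q l ih =>
    have h' := List.isChain_cons_cons.1 h
    rw [prod_cons, ii, ih q h'.2]
    change (φ p ×ₚ φ q).1 = _
    rw [← φ.map_times, h'.1.1]
    rfl

theorem ast_prod (a : PPath P) : BiUnary.ast (prod φ a) = (φ a.ran).1 := by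
  obtain ⟨p, l, h⟩ := a
  induction l generalizing p with
  | nil => exact ast_val _
  | cons q l ih =>
    have h' := List.isChain_cons_cons.1 h
    have h1 : BiUnary.ast ((φ p).1 * (φ q).1) = (φ q).1 := by
      change (φ p ⋆ₚ φ q).1 = _
      rw [← φ.map_star, h'.1.2]
    -- The head `q` is doubled so that `ii'` can replace the prefix `(pφ)(qφ)` by its `*`, which is
    -- `qφ`.
    rw [prod_cons, ← val_mul_prod φ ⟨q, l, h'.2⟩, ← assoc, ii']
    change BiUnary.ast (BiUnary.ast ((φ p).1 * (φ q).1) * _) = _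
    rw [h1]
    exact (congrArg _ (val_mul_prod φ ⟨q, l, h'.2⟩)).trans (ih q h'.2)

variable [IsStrongProjectionAlgebra P]

/-- A loop is idempotency; both sides of an admissible generator reduce to `(eφ)(pφ)(fφ)`. -/
theorem prod_congr {a b : PPath P} (h : ChainCongr a b) : prod φ a = prod φ b := by
  induction h with
  | loop p => exact val_mul_self _
  | adm e p f h =>
    change (φ e).1 * (φ (e ⋆ₚ p)).1 * (φ f).1 = (φ e).1 * (φ (p ×ₚ f)).1 * (φ f).1
    rw [mul_map_star, assoc, assoc, map_times_mul]
  | refl a => rfl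
  | symm _ ih => exact ih.symm
  | trans _ _ ih₁ ih₂ => exact ih₁.trans ih₂
  | comp_left u ha hb _ ih => rw [prod_comp, prod_comp, ih]
  | comp_right v ha hb _ ih => rw [prod_comp, prod_comp, ih]

theorem prod_rightRestrict (a : PPath P) {q : P} (h : Le q a.ran) :
    prod φ (rightRestrict a q h) = prod φ a * (φ q).1 := by
  obtain ⟨p, l, ha⟩ := a
  induction l generalizing p with
  | nil => exact (map_mul_map_of_le φ h).symm
  | cons p' l ih =>
    have h' := (List.isChain_cons_cons.1 ha).2
    have h1 := ih p' h' h
    -- Doubling the head `r` of the restricted tail lets `pφ · rφ` be rewritten as `(p × r)φ · rφ`,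
    -- which supplies the new first entry.
    rw [prod_cons, assoc, ← h1, ← val_mul_prod φ (rightRestrict ⟨p', l, h'⟩ q h), ← assoc,
      ← map_times_mul, assoc, val_mul_prod]
    exact foldl_mul φ _ _ _

theorem prod_leftRestrict (a : PPath P) {q : P} (h : Le q a.dom) :
    prod φ (leftRestrict q a h) = (φ q).1 * prod φ a := by
  obtain ⟨p, l, ha⟩ := a
  induction l generalizing p q with
  | nil => exact (map_mul_map_of_ge φ h).symm
  | cons p' l ih =>
    have h' := (List.isChain_cons_cons.1 ha).2
    have h1 := ih p' h' (q := q ⋆ₚ p') (star_le q p')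
    have h2 : (φ q).1 * prod φ ⟨p', l, h'⟩ =
        (φ q).1 * ((φ (q ⋆ₚ p')).1 * prod φ ⟨p', l, h'⟩) := by
      rw [← assoc, mul_map_star, assoc]
      exact congrArg _ (val_mul_prod φ ⟨p', l, h'⟩).symm
    rw [prod_cons, ← assoc]
    refine Eq.trans ?_ (congrArg (· * _) (map_mul_map_of_ge φ (show Le q p from h)).symm)
    rw [h2, ← h1]
    exact foldl_mul φ _ _ _

theorem prod_bullet (a b : PPath P) : prod φ (a.bullet b) = prod φ a * prod φ b := by
  -- Writing `p × q` as `p × (p ⋆ q)` makes the link evaluate to `(pφ)((p ⋆ q)φ)`, hence to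
  -- `(pφ)(qφ)`; the outer products absorb these two factors.
  have h1 : (φ (a.ran ×ₚ b.dom)).1 * (φ (a.ran ⋆ₚ b.dom)).1 = (φ a.ran).1 * (φ b.dom).1 := by
    rw [← times_star_left, map_times_mul, mul_map_star]
  have h2 : prod φ a * (φ a.ran).1 = prod φ a := by rw [← ast_prod, i']
  refine (prod_comp φ _ _ _).trans ?_
  refine (congrArg (· * _) (prod_comp φ _ _ _)).trans ?_
  rw [prod_rightRestrict, prod_leftRestrict]
  change prod φ a * _ * ((φ (a.ran ×ₚ b.dom)).1 * (φ (a.ran ⋆ₚ b.dom)).1) * _ = _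
  rw [assoc (prod φ a), ← assoc (φ (a.ran ×ₚ b.dom)).1 (φ (a.ran ×ₚ b.dom)).1, val_mul_self,
    assoc, assoc, ← assoc _ _ (prod φ b), val_mul_self, ← assoc (φ (a.ran ×ₚ b.dom)).1, h1,
    assoc, val_mul_prod, ← assoc, h2]

end PPath

/-! ### The induced homomorphism and the theorem. -/

namespace ChainSemigroup

variable {P S : Type*} [ProjectionOps P] [IsStrongProjectionAlgebra P] [BiUnary S]
  [IsDRCRestriction S]

/-- The extension `[p₁, …, p_k] ↦ (p₁φ)⋯(p_kφ)` of `φ` to the chain semigroup. -/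
def lift (φ : ProjectionHom P (Projections S)) : BiUnaryHom (ChainSemigroup P) S where
  toFun := Quotient.lift (PPath.prod φ) (fun _ _ h => PPath.prod_congr φ h)
  map_mul x y := by
    induction x, y using Quotient.inductionOn₂ with
    | h a b => exact PPath.prod_bullet φ a b
  map_plus x := by
    induction x using Quotient.inductionOn with
    | h a => exact (PPath.plus_prod φ a).symm
  map_ast x := by
    induction x using Quotient.inductionOn with
    | h a => exact (PPath.ast_prod φ a).symm

end ChainSemigroup

end ProjectionAlgebra

theorem theorem7p16 {P : Type*} {S : Type*}
    [ProjectionOps P] [IsStrongProjectionAlgebra P]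
    [BiUnary S] [IsDRCRestriction S]
    (φ : ProjectionHom P (Projections S)) :
    IsDRCRestriction (ProjectionAlgebra.ChainSemigroup P) ∧
    ∃ Φ : BiUnaryHom (ProjectionAlgebra.ChainSemigroup P) S,
      (∀ p : P, Φ (ProjectionAlgebra.ChainSemigroup.mk (ProjectionAlgebra.PPath.single p))
        = (φ p).1) ∧
      (∀ a : ProjectionAlgebra.PPath P,
        Φ (ProjectionAlgebra.ChainSemigroup.mk a) = ProjectionAlgebra.PPath.prod φ a) ∧
      ∀ Ψ : BiUnaryHom (ProjectionAlgebra.ChainSemigroup P) S,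
        (∀ p : P, Ψ (ProjectionAlgebra.ChainSemigroup.mk (ProjectionAlgebra.PPath.single p))
          = (φ p).1) → Ψ = Φ := by
  refine ⟨inferInstance, ProjectionAlgebra.ChainSemigroup.lift φ, fun _ => rfl, fun _ => rfl, ?_⟩
  intro Ψ h
  exact ProjectionAlgebra.ChainSemigroup.hom_ext h
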